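/- All graphs are finite and simple. For a graph $G$ and $X\subseteq V(G)$, vertices $u,v$ are *$X$-positionable* if no shortest $u,v$-path contains a vertex of $X$ other than (possibly) $u$ and $v$ themselves. The set $X$ is an *outer general position set* of $G$ if $u,v$ are $X$-positionable for all $u,v\in X$ and for all $u\in X$, $v\in V(G)\setminus X$; $\mathrm{gp}_{\rm o}(G)$ is the largest cardinality of such a set. Two distinct vertices are *true twins* if their closed neighborhoods are equal; a vertex is *universal* if it is adjacent to all other vertices; $\alpha(H)$ is the independence number of $H$; $K_1+H$ is the join of a one-vertex graph with $H$. The *lexicographic product* $G\circ H$ has vertex set $V(G)\times V(H)$, with $(g,h)$ and $(g',h')$ adjacent if $gg'\in E(G)$, or $g=g'$ and $hh'\in E(H)$. **Theorem.** Let $G$ be a connected graph of order at least $2$ without true twins, and let $H$ be a non-complete graph (not necessarily connected). 1. If $H$ has no universal vertex, then $\mathrm{gp}_{\rm o}(G\circ H)=\mathrm{gp}_{\rm o}(G)\,\mathrm{gp}_{\rm o}(K_1+H)$. 2. If $H$ is connected with $\mathrm{diam}(H)=2$, then $\mathrm{gp}_{\rm o}(G\circ H)=\mathrm{gp}_{\rm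 o}(G)\,\mathrm{gp}_{\rm o}(H)$. 3. If $H$ has no true twins, then $\mathrm{gp}_{\rm o}(G\circ H)=\mathrm{gp}_{\rm o}(G)\,\alpha(H)$. -/

import Mathlib

namespace OuterGP

/-- `u` and `v` are `X`-positionable in `G`: no shortest `u,v`-path contains a vertex of `X`
other than (possibly) its end-vertices `u` and `v`. -/
def Positionable {V : Type*} (G : SimpleGraph V) (X : Set V) (u v : V) : Prop :=
  ∀ p : G.Walk u v, p.IsPath → p.length = G.dist u v →
    ∀ w ∈ p.support, w ∈ X → w = u ∨ w = v

/-- `X` is an outer general position set of `G`: every two vertices of `X`, and every vertex of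
`X` together with every vertex outside `X`, are `X`-positionable. -/
def IsOuterGeneralPosition {V : Type*} (G : SimpleGraph V) (X : Set V) : Prop :=
  (∀ u ∈ X, ∀ v ∈ X, Positionable G X u v) ∧ (∀ u ∈ X, ∀ v ∈ Xᶜ, Positionable G X u v)

/-- The outer general position number: the largest cardinality of an outer general position set
(meant for graphs with finitely many vertices). -/
noncomputable def gpo {V : Type*} (G : SimpleGraph V) : ℕ :=
  sSup {n | ∃ X : Set V, IsOuterGeneralPosition G X ∧ X.ncard = n}

/-- On a finite graph the number `gpo` is attained, and it bounds every outer general position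
set. -/
theorem gpo_isGreatest {V : Type*} [Finite V] (G : SimpleGraph V) :
    IsGreatest {n | ∃ X : Set V, IsOuterGeneralPosition G X ∧ X.ncard = n} (gpo G) := by
  have hne : {n | ∃ X : Set V, IsOuterGeneralPosition G X ∧ X.ncard = n}.Nonempty :=
    ⟨0, ∅, by simp [IsOuterGeneralPosition], by simp⟩
  have hb : BddAbove {n | ∃ X : Set V, IsOuterGeneralPosition G X ∧ X.ncard = n} := by
    refine ⟨Nat.card V, ?_⟩
    rintro n ⟨X, -, rfl⟩
    exact Set.ncard_le_card X
  exact ⟨Nat.sSup_mem hne hb, fun n hn => le_csSup hb hn⟩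

/-- Distinct vertices `u` and `v` are true twins if their closed neighborhoods coincide. -/
def TrueTwins {V : Type*} (G : SimpleGraph V) (u v : V) : Prop :=
  u ≠ v ∧ insert u (G.neighborSet u) = insert v (G.neighborSet v)

/-- `G` has no true twins. -/
def NoTrueTwins {V : Type*} (G : SimpleGraph V) : Prop :=
  ∀ u v : V, ¬ TrueTwins G u v

/-- The lexicographic product `G ∘ H`. -/
def lexProd {V W : Type*} (G : SimpleGraph V) (H : SimpleGraph W) : SimpleGraph (V × W) where
  Adj x y := (x.1 = y.1 ∧ H.Adj x.2 y.2) ∨ G.Adj x.1 y.1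
  symm := ⟨by
    rintro x y (⟨h, h'⟩ | h)
    · exact Or.inl ⟨h.symm, h'.symm⟩
    · exact Or.inr h.symm⟩
  loopless := ⟨by
    rintro x (⟨_, h⟩ | h)
    · exact h.ne rfl
    · exact h.ne rfl⟩

/-- The join `G + H`: the disjoint union of `G` and `H` together with all edges between
a vertex of `G` and a vertex of `H`. -/
def join {V W : Type*} (G : SimpleGraph V) (H : SimpleGraph W) : SimpleGraph (V ⊕ W) where
  Adj x y := (SimpleGraph.sum G H).Adj x y ∨ (x.isLeft ∧ y.isRight) ∨ (x.isRight ∧ y.isLeft)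
  symm := ⟨by
    rintro x y (h | ⟨h, h'⟩ | ⟨h, h'⟩)
    · exact Or.inl h.symm
    · exact Or.inr (Or.inr ⟨h', h⟩)
    · exact Or.inr (Or.inl ⟨h', h⟩)⟩
  loopless := ⟨by
    rintro x (h | ⟨h, h'⟩ | ⟨h, h'⟩)
    · exact h.ne rfl
    · cases x <;> simp_all
    · cases x <;> simp_all⟩

/-- The graph `K₁` with a single vertex. -/
abbrev K1 : SimpleGraph Unit := ⊤

end OuterGP

/-! In a connected graph, outer general position means that the vertices are pairwise maximally
distant. Adjacent vertices are mutually maximally distant exactly when they are true twins, so in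
`G` such sets are independent. Distances in `G ∘ H` come from `G` between different fibers and are
at most 2 within a fiber. Hence a set is admissible iff its projection to `G` is and adjacent
vertices in each fiber are true twins of `H` (`isOuterGeneralPosition_lexProd_iff`). Counting fibers
gives `gpo G * twinIndepNum H` (`gpo_lexProd`). The three claims evaluate `twinIndepNum H`: with
diameter at most 2 it is `gpo`, a join with `K1` reduces to that case, and without true twins it is
the independence number. -/

namespace OuterGP

open SimpleGraph

variable {V W : Type*} {G : SimpleGraph V} {H : SimpleGraph W}

/-! ### Positionability and maximal distance -/

/-- `w` is maximally distant from `u`: no neighbor of `w` is farther from `u` than `w`. -/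
def MaxDistant (G : SimpleGraph V) (u w : V) : Prop :=
  ∀ v, G.Adj w v → G.dist u v ≤ G.dist u w

/-- On a shortest path from `u`, the vertex following `w` would be farther from `u` than `w`. -/
theorem positionable_of_maxDistant (hG : G.Connected) {X : Set V} {u : V}
    (hX : ∀ w ∈ X, u ≠ w → MaxDistant G u w) (v : V) : Positionable G X u v := by
  intro p _ hp w hw hwX
  by_contra! hne
  obtain ⟨q, r, rfl⟩ := Walk.mem_support_iff_exists_append.mp hw
  cases r with
  | nil => exact hne.2 rfl
  | @cons _ x _ h r =>
    have h1 := hX w hwX hne.1.symm x h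
    have h2 := hG.dist_triangle (u := u) (v := x) (w := v)
    have h3 := dist_le q
    have h4 := dist_le r
    simp only [Walk.length_append, Walk.length_cons] at hp
    omega

/-- A farther neighbor of `w` would extend a shortest `u,w`-path to a shortest path with `w` in its
interior. -/
theorem maxDistant_of_positionable (hG : G.Connected) {X : Set V} {u w : V}
    (hX : ∀ v, Positionable G X u v) (hw : w ∈ X) (hne : u ≠ w) : MaxDistant G u w := by
  intro v hv
  by_contra! hlt
  obtain ⟨p, hp⟩ := hG.exists_walk_length_eq_dist u w
  have hlen : (p.concat hv).length = G.dist u v := by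
    have := dist_le (p.concat hv)
    rw [Walk.length_concat] at this ⊢
    omega
  rcases hX v (p.concat hv) (Walk.isPath_of_length_eq_dist _ hlen) hlen w (by simp) hw with h | h
  · exact hne h.symm
  · exact hv.ne h

/-- In a connected graph, the outer general position sets are the sets of pairwise maximally
distant vertices. -/
theorem isOuterGeneralPosition_iff (hG : G.Connected) {X : Set V} :
    IsOuterGeneralPosition G X ↔ ∀ u ∈ X, ∀ w ∈ X, u ≠ w → MaxDistant G u w := by
  constructor
  · rintro ⟨h1, h2⟩ u hu w hw hne
    refine maxDistant_of_positionable hG (fun v => ?_) hw hne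
    by_cases hv : v ∈ X
    exacts [h1 u hu v hv, h2 u hu v hv]
  · intro h
    exact ⟨fun u hu v _ => positionable_of_maxDistant hG (h u hu) v,
      fun u hu v _ => positionable_of_maxDistant hG (h u hu) v⟩

/-! ### True twins -/

theorem trueTwins_iff {u v : V} :
    TrueTwins G u v ↔ G.Adj u v ∧ ∀ w, w ≠ u → w ≠ v → (G.Adj u w ↔ G.Adj v w) := by
  constructor
  · rintro ⟨hne, h⟩
    simp only [Set.ext_iff, Set.mem_insert_iff, mem_neighborSet] at h
    refine ⟨?_, fun w h1 h2 => ?_⟩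
    · simpa [hne.symm] using h v
    · simpa [h1, h2] using h w
  · rintro ⟨h1, h2⟩
    refine ⟨h1.ne, ?_⟩
    ext w
    simp only [Set.mem_insert_iff, mem_neighborSet]
    by_cases hu : w = u
    · subst hu; simp [h1.symm]
    by_cases hv : w = v
    · subst hv; simp [h1]
    simp [hu, hv, h2 w hu hv]

theorem adj_of_dist_le_one (hG : G.Connected) {u v : V} (hne : u ≠ v) (h : G.dist u v ≤ 1) :
    G.Adj u v := by
  have := hG.pos_dist_of_ne hne
  exact dist_eq_one_iff_adj.mp (by omega)

theorem two_le_dist (hG : G.Connected) {u v : V} (hne : u ≠ v) (h : ¬ G.Adj u v) :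
    2 ≤ G.dist u v :=
  hG.one_lt_dist_of_ne_of_not_adj hne h

theorem MaxDistant.adj_of_adj (hG : G.Connected) {u v w : V} (h : MaxDistant G u v)
    (huv : G.Adj u v) (hvw : G.Adj v w) (hne : w ≠ u) : G.Adj u w :=
  adj_of_dist_le_one hG hne.symm (by simpa [dist_eq_one_iff_adj.mpr huv] using h w hvw)

theorem trueTwins_of_maxDistant (hG : G.Connected) {u v : V} (huv : G.Adj u v)
    (h : MaxDistant G u v) (h' : MaxDistant G v u) : TrueTwins G u v :=
  trueTwins_iff.mpr ⟨huv, fun _ hu hv =>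
    ⟨fun hw => h'.adj_of_adj hG huv.symm hw hv, fun hw => h.adj_of_adj hG huv hw hu⟩⟩

theorem TrueTwins.maxDistant {u v : V} (h : TrueTwins G u v) : MaxDistant G u v := by
  intro w hw
  obtain ⟨h1, h2⟩ := trueTwins_iff.mp h
  rw [dist_eq_one_iff_adj.mpr h1]
  by_cases hu : w = u
  · simp [hu]
  · exact (dist_eq_one_iff_adj.mpr ((h2 w hu hw.ne').mpr hw)).le

theorem not_adj_of_isOuterGeneralPosition (hG : G.Connected) (ht : NoTrueTwins G) {X : Set V}
    (hX : IsOuterGeneralPosition G X) {u v : V} (hu : u ∈ X) (hv : v ∈ X) : ¬ G.Adj u v := by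
  rw [isOuterGeneralPosition_iff hG] at hX
  exact fun h => ht u v (trueTwins_of_maxDistant hG h (hX u hu v hv h.ne) (hX v hv u hu h.ne'))

/-! ### Sets whose adjacent pairs are true twins -/

/-- A set of vertices all of whose adjacent pairs are true twins. -/
def IsTwinIndep (H : SimpleGraph W) (T : Set W) : Prop :=
  ∀ u ∈ T, ∀ v ∈ T, H.Adj u v → TrueTwins H u v

/-- The largest cardinality of a set all of whose adjacent pairs are true twins. -/
noncomputable def twinIndepNum (H : SimpleGraph W) : ℕ :=
  sSup {n | ∃ T : Set W, IsTwinIndep H T ∧ T.ncard = n}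

theorem twinIndepNum_isGreatest [Finite W] (H : SimpleGraph W) :
    IsGreatest {n | ∃ T : Set W, IsTwinIndep H T ∧ T.ncard = n} (twinIndepNum H) := by
  have hb : BddAbove {n | ∃ T : Set W, IsTwinIndep H T ∧ T.ncard = n} := by
    refine ⟨Nat.card W, ?_⟩
    rintro n ⟨T, -, rfl⟩
    exact Set.ncard_le_card T
  exact ⟨Nat.sSup_mem ⟨0, ∅, by simp [IsTwinIndep], by simp⟩ hb, fun n hn => le_csSup hb hn⟩

theorem IsTwinIndep.ncard_le [Finite W] {T : Set W} (hT : IsTwinIndep H T) :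
    T.ncard ≤ twinIndepNum H :=
  (twinIndepNum_isGreatest H).2 ⟨T, hT, rfl⟩

theorem IsOuterGeneralPosition.ncard_le [Finite V] {X : Set V}
    (hX : IsOuterGeneralPosition G X) : X.ncard ≤ gpo G :=
  (gpo_isGreatest G).2 ⟨X, hX, rfl⟩

theorem isOuterGeneralPosition_iff_isTwinIndep (hG : G.Connected)
    (hd : ∀ u v, G.dist u v ≤ 2) {X : Set V} :
    IsOuterGeneralPosition G X ↔ IsTwinIndep G X := by
  rw [isOuterGeneralPosition_iff hG]
  constructor
  · exact fun h u hu v hv huv =>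
      trueTwins_of_maxDistant hG huv (h u hu v hv huv.ne) (h v hv u hu huv.ne')
  · intro h u hu v hv hne
    -- Non-adjacent vertices already realize the largest possible distance 2.
    by_cases huv : G.Adj u v
    · exact (h u hu v hv huv).maxDistant
    · exact fun w _ => (hd u w).trans (two_le_dist hG hne huv)

theorem gpo_eq_twinIndepNum (hG : G.Connected) (hd : ∀ u v, G.dist u v ≤ 2) :
    gpo G = twinIndepNum G := by
  simp only [gpo, twinIndepNum, isOuterGeneralPosition_iff_isTwinIndep hG hd]

theorem gpo_eq_twinIndepNum_of_diam [Nonempty V] (hd : G.diam = 2) : gpo G = twinIndepNum G := by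
  -- `diam` is 0 when `ediam` is infinite, so the value 2 forces connectedness.
  have h : G.ediam ≠ ⊤ := ediam_ne_top_of_diam_ne_zero (by omega)
  exact gpo_eq_twinIndepNum (connected_of_ediam_ne_top h) fun u v => hd ▸ dist_le_diam h

theorem twinIndepNum_eq_indepNum [Finite W] (ht : NoTrueTwins H) :
    twinIndepNum H = H.indepNum := by
  apply le_antisymm
  · obtain ⟨T, hT, hc⟩ := (twinIndepNum_isGreatest H).1
    rw [← hc, Set.ncard_eq_toFinset_card T]
    refine IsIndepSet.card_le_indepNum ?_
    intro u hu v hv _ huv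
    simp only [Set.Finite.coe_toFinset] at hu hv
    exact ht u v (hT u hu v hv huv)
  · obtain ⟨s, hs⟩ := H.exists_isNIndepSet_indepNum
    rw [← hs.card_eq, ← Set.ncard_coe_finset]
    exact IsTwinIndep.ncard_le fun u hu v hv huv => (hs.isIndepSet hu hv huv.ne huv).elim

/-! ### The join with a single vertex -/

@[simp] theorem join_K1_adj_inr {u v : W} :
    (join K1 H).Adj (Sum.inr u) (Sum.inr v) ↔ H.Adj u v := by
  simp [join]

@[simp] theorem join_K1_adj_inl_inr {a : Unit} {v : W} :
    (join K1 H).Adj (Sum.inl a) (Sum.inr v) := by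
  simp [join]

theorem join_K1_isUniversal (H : SimpleGraph W) : (join K1 H).IsUniversal (Sum.inl ()) := by
  rintro (a | v) h
  · exact (h rfl).elim
  · exact join_K1_adj_inl_inr

theorem dist_le_two_of_isUniversal {a : V} (ha : G.IsUniversal a) (u v : V) :
    G.dist u v ≤ 2 := by
  have h1 : ∀ w, G.dist a w ≤ 1 := fun w => by
    by_cases h : a = w
    · simp [h]
    · exact (dist_eq_one_iff_adj.mpr (ha h)).le
  have h2 := (Connected.of_isUniversal ha).dist_triangle (u := u) (v := a) (w := v)
  rw [G.dist_comm (u := u) (v := a)] at h2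
  have := h1 u
  have := h1 v
  omega

theorem trueTwins_join_K1_inr {u v : W} :
    TrueTwins (join K1 H) (Sum.inr u) (Sum.inr v) ↔ TrueTwins H u v := by
  simp only [trueTwins_iff, join_K1_adj_inr, Sum.forall, ne_eq, Sum.inr.injEq]
  refine and_congr_right fun _ => and_iff_right fun a _ _ => ?_
  exact iff_of_true join_K1_adj_inl_inr.symm join_K1_adj_inl_inr.symm

theorem not_trueTwins_join_K1_inl (hH : ∀ w, ¬ H.IsUniversal w) (v : W) :
    ¬ TrueTwins (join K1 H) (Sum.inl ()) (Sum.inr v) := by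
  intro h
  refine hH v fun w hw => join_K1_adj_inr.mp ?_
  exact ((trueTwins_iff.mp h).2 (Sum.inr w) (by simp) (by simpa using hw.symm)).mp
    join_K1_adj_inl_inr

theorem twinIndepNum_pos [Finite W] [Nonempty W] (H : SimpleGraph W) : 0 < twinIndepNum H := by
  have w : W := Classical.arbitrary W
  have h : IsTwinIndep H {w} := by
    rintro u rfl v rfl h
    exact (h.ne rfl).elim
  have := h.ncard_le
  rw [Set.ncard_singleton] at this
  omega

theorem isTwinIndep_join_K1_image {T : Set W} :
    IsTwinIndep (join K1 H) (Sum.inr '' T) ↔ IsTwinIndep H T := by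
  simp [IsTwinIndep, trueTwins_join_K1_inr]

theorem twinIndepNum_join_K1 [Finite W] [Nonempty W] (hH : ∀ w, ¬ H.IsUniversal w) :
    twinIndepNum (join K1 H) = twinIndepNum H := by
  apply le_antisymm
  · obtain ⟨X, hX, hc⟩ := (twinIndepNum_isGreatest (join K1 H)).1
    rw [← hc]
    -- The apex is adjacent to everything and has no true twin, so a set containing it is a
    -- singleton.
    by_cases hl : Sum.inl () ∈ X
    · have hsub : X ⊆ {Sum.inl ()} := by
        rintro (a | v) hx
        · rfl
        · exact (not_trueTwins_join_K1_inl hH v (hX _ hl _ hx join_K1_adj_inl_inr)).elim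
      calc X.ncard ≤ ({Sum.inl ()} : Set (Unit ⊕ W)).ncard := Set.ncard_le_ncard hsub
        _ = 1 := Set.ncard_singleton _
        _ ≤ _ := twinIndepNum_pos H
    · have himg : X = Sum.inr '' (Sum.inr ⁻¹' X) := by
        refine (Set.image_preimage_eq_iff.mpr ?_).symm
        rintro (a | v) hx
        · exact (hl hx).elim
        · exact ⟨v, rfl⟩
      rw [himg] at hX ⊢
      rw [Set.ncard_image_of_injective _ Sum.inr_injective]
      exact (isTwinIndep_join_K1_image.mp hX).ncard_le
  · obtain ⟨T, hT, hc⟩ := (twinIndepNum_isGreatest H).1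
    rw [← hc, ← Set.ncard_image_of_injective T (Sum.inr_injective (α := Unit))]
    exact (isTwinIndep_join_K1_image.mpr hT).ncard_le

theorem gpo_join_K1 [Finite W] [Nonempty W] (hH : ∀ w, ¬ H.IsUniversal w) :
    gpo (join K1 H) = twinIndepNum H := by
  have hu := join_K1_isUniversal H
  rw [gpo_eq_twinIndepNum (Connected.of_isUniversal hu) (dist_le_two_of_isUniversal hu),
    twinIndepNum_join_K1 hH]

/-! ### Distances in the lexicographic product -/

theorem lexProd_adj {x y : V × W} :
    (lexProd G H).Adj x y ↔ (x.1 = y.1 ∧ H.Adj x.2 y.2) ∨ G.Adj x.1 y.1 := Iff.rfl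

theorem lexProd_adj_of_adj {x y : V × W} (h : G.Adj x.1 y.1) : (lexProd G H).Adj x y := Or.inr h

theorem lexProd_adj_of_ne {x y : V × W} (h : x.1 ≠ y.1) :
    (lexProd G H).Adj x y ↔ G.Adj x.1 y.1 := by
  simp [lexProd_adj, h]

theorem lexProd_adj_fiber {g : V} {h h' : W} :
    (lexProd G H).Adj (g, h) (g, h') ↔ H.Adj h h' := by
  simp [lexProd_adj]

theorem dist_fst_le_length (hG : G.Connected) {x y : V × W} (p : (lexProd G H).Walk x y) :
    G.dist x.1 y.1 ≤ p.length := by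
  induction p with
  | nil => simp
  | @cons a b c h p ih =>
    have h1 := hG.dist_triangle (u := a.1) (v := b.1) (w := c.1)
    have h2 : G.dist a.1 b.1 ≤ 1 := by
      rcases h with ⟨h, _⟩ | h
      · simp [h]
      · exact (dist_eq_one_iff_adj.mpr h).le
    rw [Walk.length_cons]
    omega

/-- The second coordinate can be changed freely on any edge of `G`; here the last edge does it, so
the walk needs at least one edge. -/
theorem exists_lexProd_walk {g g' : V} (p : G.Walk g g') (hp : p.length ≠ 0) (h h' : W) :
    ∃ q : (lexProd G H).Walk (g, h) (g', h'), q.length = p.length := by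
  induction p with
  | nil => simp at hp
  | @cons a b c hab p ih =>
    by_cases h0 : p.length = 0
    · obtain rfl := Walk.eq_of_length_eq_zero h0
      exact ⟨Walk.cons (lexProd_adj_of_adj hab) Walk.nil, by simp [Walk.length_cons, h0]⟩
    · obtain ⟨q, hq⟩ := ih h0
      exact ⟨Walk.cons (v := (b, h)) (lexProd_adj_of_adj hab) q, by simp [Walk.length_cons, hq]⟩

theorem lexProd_connected [Nontrivial V] [Nonempty W] (hG : G.Connected) :
    (lexProd G H).Connected := by
  refine ⟨fun ⟨g, h⟩ ⟨g', h'⟩ => ?_⟩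
  obtain ⟨a, ha⟩ := hG.preconnected.exists_adj_of_nontrivial g
  obtain ⟨p⟩ := hG.preconnected a g'
  -- The extra first edge keeps the walk nonempty even when `g = g'`.
  obtain ⟨q, -⟩ := exists_lexProd_walk (H := H) (Walk.cons ha p) (by simp) h h'
  exact ⟨q⟩

theorem lexProd_dist_of_ne [Nontrivial V] [Nonempty W] (hG : G.Connected) {x y : V × W}
    (hne : x.1 ≠ y.1) : (lexProd G H).dist x y = G.dist x.1 y.1 := by
  apply le_antisymm
  · obtain ⟨p, hp⟩ := hG.exists_walk_length_eq_dist x.1 y.1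
    have hpos := hG.pos_dist_of_ne hne
    obtain ⟨q, hq⟩ := exists_lexProd_walk (H := H) p (by omega) x.2 y.2
    rw [← hp, ← hq]
    exact dist_le q
  · obtain ⟨p, hp⟩ := (lexProd_connected (H := H) hG).exists_walk_length_eq_dist x y
    rw [← hp]
    exact dist_fst_le_length hG p

theorem lexProd_dist_fiber_le [Nontrivial V] (hG : G.Connected) {x y : V × W} (hxy : x.1 = y.1) :
    (lexProd G H).dist x y ≤ 2 := by
  obtain ⟨a, ha⟩ := hG.preconnected.exists_adj_of_nontrivial x.1
  have h1 : (lexProd G H).Adj x (a, x.2) := lexProd_adj_of_adj ha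
  have h2 : (lexProd G H).Adj (a, x.2) y := lexProd_adj_of_adj (hxy ▸ ha.symm)
  exact dist_le (Walk.cons h1 (Walk.cons h2 Walk.nil))

/-! ### Maximal distance in the lexicographic product -/

theorem trueTwins_of_lexProd {g : V} {h h' : W}
    (ht : TrueTwins (lexProd G H) (g, h) (g, h')) : TrueTwins H h h' := by
  obtain ⟨h1, h2⟩ := trueTwins_iff.mp ht
  refine trueTwins_iff.mpr ⟨lexProd_adj_fiber.mp h1, fun w hw hw' => ?_⟩
  simpa only [lexProd_adj_fiber] using h2 (g, w) (by simpa using hw) (by simpa using hw')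

theorem TrueTwins.lexProd {h h' : W} (ht : TrueTwins H h h') (g : V) :
    TrueTwins (lexProd G H) (g, h) (g, h') := by
  obtain ⟨h1, h2⟩ := trueTwins_iff.mp ht
  refine trueTwins_iff.mpr ⟨lexProd_adj_fiber.mpr h1, ?_⟩
  rintro ⟨a, b⟩ ha hb
  by_cases hg : g = a
  · subst hg
    simpa only [lexProd_adj_fiber] using h2 b (by simpa using ha) (by simpa using hb)
  · simp [lexProd_adj, hg]

theorem maxDistant_fst [Nontrivial V] [Nonempty W] (hG : G.Connected) {x y : V × W}
    (hne : x.1 ≠ y.1) (h : MaxDistant (lexProd G H) x y) : MaxDistant G x.1 y.1 := by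
  intro v hv
  by_cases hxv : x.1 = v
  · simp [hxv]
  · have := h (v, y.2) (Or.inr hv)
    rwa [lexProd_dist_of_ne hG hxv, lexProd_dist_of_ne hG hne] at this

theorem maxDistant_lexProd [Nontrivial V] [Nonempty W] (hG : G.Connected) {x y : V × W}
    (hne : x.1 ≠ y.1) (hadj : ¬ G.Adj x.1 y.1) (h : MaxDistant G x.1 y.1) :
    MaxDistant (lexProd G H) x y := by
  intro z hz
  rw [lexProd_dist_of_ne hG hne]
  by_cases hxz : x.1 = z.1
  -- A neighbor of `y` in the fiber of `x` may be at distance 2 from `x`; non-adjacency in `G` keeps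
  -- that from exceeding the distance to `y`.
  · exact (lexProd_dist_fiber_le hG hxz).trans (two_le_dist hG hne hadj)
  · rw [lexProd_dist_of_ne hG hxz]
    rcases hz with ⟨hz, -⟩ | hz
    · rw [hz]
    · exact h z.1 hz

theorem maxDistant_lexProd_fiber [Nontrivial V] [Nonempty W] (hG : G.Connected) {g : V} {h h' : W}
    (hne : h ≠ h') (hadj : ¬ H.Adj h h') : MaxDistant (lexProd G H) (g, h) (g, h') := by
  have h2 : 2 ≤ (lexProd G H).dist (g, h) (g, h') :=
    two_le_dist (lexProd_connected hG) (by simpa using hne) (by rwa [lexProd_adj_fiber])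
  rintro z hz
  refine le_trans ?_ h2
  by_cases hgz : g = z.1
  · exact lexProd_dist_fiber_le hG hgz
  · have hz' : G.Adj g z.1 := (lexProd_adj_of_ne hgz).mp hz
    rw [lexProd_dist_of_ne hG hgz, dist_eq_one_iff_adj.mpr hz']
    norm_num

/-- If `G` has no true twins, then a set is in outer general position in `G ∘ H` if and only if its
projection to `G` is, and adjacent vertices in its fibers are true twins of `H`. -/
theorem isOuterGeneralPosition_lexProd_iff [Nontrivial V] [Nonempty W] (hG : G.Connected)
    (ht : NoTrueTwins G) {X : Set (V × W)} :
    IsOuterGeneralPosition (lexProd G H) X ↔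
      IsOuterGeneralPosition G (Prod.fst '' X) ∧ ∀ g, IsTwinIndep H {h | (g, h) ∈ X} := by
  have hc := lexProd_connected (H := H) hG
  constructor
  · intro hX
    rw [isOuterGeneralPosition_iff hc] at hX
    constructor
    · rw [isOuterGeneralPosition_iff hG]
      rintro _ ⟨x, hx, rfl⟩ _ ⟨y, hy, rfl⟩ hne
      exact maxDistant_fst hG hne (hX x hx y hy (fun h => hne (congrArg Prod.fst h)))
    · intro g h hh h' hh' hadj
      have hadj' : (lexProd G H).Adj (g, h) (g, h') := lexProd_adj_fiber.mpr hadj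
      exact trueTwins_of_lexProd (trueTwins_of_maxDistant hc hadj'
        (hX _ hh _ hh' hadj'.ne) (hX _ hh' _ hh hadj'.ne'))
  · rintro ⟨hP, hF⟩
    rw [isOuterGeneralPosition_iff hc]
    rintro ⟨g, h⟩ hx ⟨g', h'⟩ hy hne
    by_cases hg : g = g'
    · subst hg
      by_cases hadj : H.Adj h h'
      · exact ((hF g h hx h' hy hadj).lexProd g).maxDistant
      · exact maxDistant_lexProd_fiber hG (fun e => hne (by rw [e])) hadj
    · exact maxDistant_lexProd hG hg
        (not_adj_of_isOuterGeneralPosition hG ht hP ⟨_, hx, rfl⟩ ⟨_, hy, rfl⟩)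
        ((isOuterGeneralPosition_iff hG).mp hP _ ⟨_, hx, rfl⟩ _ ⟨_, hy, rfl⟩ hg)

/-! ### Counting by fibers -/

theorem ncard_le_mul_ncard_image_fst [Finite V] [Finite W] {X : Set (V × W)} {n : ℕ}
    (hX : ∀ g, {h | (g, h) ∈ X}.ncard ≤ n) : X.ncard ≤ (Prod.fst '' X).ncard * n := by
  classical
  have hfin := X.toFinite
  rw [Set.ncard_eq_toFinset_card X hfin, mul_comm,
    Set.ncard_eq_toFinset_card (Prod.fst '' X) (hfin.image _), hfin.toFinset_image]
  refine Finset.card_le_mul_card_image _ n fun g _ => ?_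
  rw [← Set.ncard_coe_finset]
  refine le_trans ?_ (hX g)
  refine Set.ncard_le_ncard_of_injOn Prod.snd ?_ ?_
  · rintro ⟨a, b⟩ hx
    obtain ⟨hab, rfl⟩ : (a, b) ∈ X ∧ a = g := by simpa using hx
    exact hab
  · rintro ⟨a, b⟩ hx ⟨c, d⟩ hy hbd
    obtain ⟨-, rfl⟩ : (a, b) ∈ X ∧ a = g := by simpa using hx
    obtain ⟨-, rfl⟩ : (c, d) ∈ X ∧ c = a := by simpa using hy
    exact Prod.ext rfl hbd

theorem gpo_lexProd [Finite V] [Finite W] [Nontrivial V] [Nonempty W] (hG : G.Connected)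
    (ht : NoTrueTwins G) : gpo (lexProd G H) = gpo G * twinIndepNum H := by
  apply le_antisymm
  · obtain ⟨X, hX, hc⟩ := (gpo_isGreatest (lexProd G H)).1
    obtain ⟨hP, hF⟩ := (isOuterGeneralPosition_lexProd_iff hG ht).mp hX
    rw [← hc]
    exact (ncard_le_mul_ncard_image_fst fun g => (hF g).ncard_le).trans
      (Nat.mul_le_mul_right _ hP.ncard_le)
  · obtain ⟨S, hS, hSc⟩ := (gpo_isGreatest G).1
    obtain ⟨T, hT, hTc⟩ := (twinIndepNum_isGreatest H).1
    -- With `T` nonempty, the extremal set `S ×ˢ T` projects onto all of `S`.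
    have hT0 : T.Nonempty := Set.nonempty_of_ncard_ne_zero (hTc ▸ (twinIndepNum_pos H).ne')
    rw [← hSc, ← hTc, ← Set.ncard_prod]
    refine IsOuterGeneralPosition.ncard_le ((isOuterGeneralPosition_lexProd_iff hG ht).mpr ⟨?_, ?_⟩)
    · rwa [Set.fst_image_prod S hT0]
    · exact fun g u hu v hv huv => hT u hu.2 v hv.2 huv

end OuterGP

theorem mainTheorem4 {V W : Type*} [Finite V] [Finite W]
    (G : SimpleGraph V) (H : SimpleGraph W)
    (hGconn : G.Connected) (hGorder : 2 ≤ Nat.card V) (hGtwins : OuterGP.NoTrueTwins G)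
    (hH : H ≠ ⊤) :
    ((∀ w : W, ¬ H.IsUniversal w) →
      OuterGP.gpo (OuterGP.lexProd G H)
        = OuterGP.gpo G * OuterGP.gpo (OuterGP.join OuterGP.K1 H)) ∧
    (H.diam = 2 →
      OuterGP.gpo (OuterGP.lexProd G H) = OuterGP.gpo G * OuterGP.gpo H) ∧
    (OuterGP.NoTrueTwins H →
      OuterGP.gpo (OuterGP.lexProd G H) = OuterGP.gpo G * H.indepNum) := by
  have : Nontrivial V := Finite.one_lt_card_iff_nontrivial.mp hGorder
  -- On an empty vertex type all graphs coincide, so `H ≠ ⊤` provides a vertex.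
  have : Nonempty W := by
    by_contra hW
    rw [not_nonempty_iff] at hW
    exact hH (Subsingleton.elim _ _)
  rw [OuterGP.gpo_lexProd hGconn hGtwins]
  refine ⟨fun hu => ?_, fun hd => ?_, fun ht => ?_⟩
  · rw [OuterGP.gpo_join_K1 hu]
  · rw [OuterGP.gpo_eq_twinIndepNum_of_diam hd]
  · rw [OuterGP.twinIndepNum_eq_indepNum ht]
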